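/- Let $m\ge 1$ and $\lambda\ge 0$ be integers, let $G$ be a nonzero abelian group, and let $A_1,\dots,A_m$ be open subsets of a topological space $X$. For a topological space $U$ and an integer $q\ge -1$, let $H_q(U)$ denote the reduced singular homology of $U$ with coefficients in $G$, i.e. the homology of the augmented singular chain complex $\cdots\to C_1(U;G)\to C_0(U;G)\to G\to 0$ with $G$ in degree $-1$; in particular $H_{-1}(U)=0$ if and only if $U\neq\varnothing$. Suppose that for every $j$ with $1\le j\le m$ and every set of indices $J\subseteq\{1,\dots,m\}$ with $|J|=j$, $$H_{m-1-j+\lambda}\Big(\bigcap_{i\in J}A_i\Big)=0 .$$ Then $$H_{m-2+\lambda}\Big(\bigcup_{i=1}^m A_i\Big)=0 .$$ -/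

import Mathlib

open CategoryTheory CategoryTheory.Limits

universe u v

noncomputable section

/-- The singular chain complex `C_*(X; G)` of a topological space `X` with coefficients in an
abelian group `G` (Mathlib's singular chain complex; `G` is lifted to a common universe). -/
def singularChains (G : Type v) [AddCommGroup G] (X : Type u) [TopologicalSpace X] :
    ChainComplex AddCommGrpCat.{max u v} ℕ :=
  ((AlgebraicTopology.singularChainComplexFunctor.{u} AddCommGrpCat.{max u v}).obj
    (AddCommGrpCat.of (ULift.{u} G))).obj (TopCat.of X)

/-- The augmentation from the `0`-chains of a simplicial set with coefficients in `R` to `R`: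
the identity of `R` on the summand of each `0`-simplex. -/
def simplicialAugmentation (S : SSet.{u}) (R : AddCommGrpCat.{max u v}) :
    (S.chainComplex R).X 0 ⟶ R :=
  Sigma.desc (fun _ ↦ 𝟙 R)

theorem ι_simplicialAugmentation (S : SSet.{u}) (R : AddCommGrpCat.{max u v})
    (x : S.obj (Opposite.op (SimplexCategory.mk 0))) :
    S.ιChainComplex x ≫ simplicialAugmentation.{u, v} S R = 𝟙 R :=
  Sigma.ι_desc _ _

theorem d_simplicialAugmentation (S : SSet.{u}) (R : AddCommGrpCat.{max u v}) :
    (S.chainComplex R).d 1 0 ≫ simplicialAugmentation.{u, v} S R = 0 := by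
  refine SSet.chainComplex_hom_ext (fun x ↦ ?_)
  rw [SSet.ιChainComplex_d_assoc]
  simp [Fin.sum_univ_two, ι_simplicialAugmentation]

/-- The augmented singular chain complex `⋯ ⟶ C_1(X; G) ⟶ C_0(X; G) ⟶ G ⟶ 0`, indexed so that
`G` sits in position `0` and `C_n(X; G)` in position `n + 1`. -/
def augmentedSingularChains (G : Type v) [AddCommGroup G] (X : Type u) [TopologicalSpace X] :
    ChainComplex AddCommGrpCat.{max u v} ℕ :=
  (singularChains G X).augment
    (simplicialAugmentation.{u, v} (TopCat.toSSet.obj (TopCat.of X))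
      (AddCommGrpCat.of (ULift.{u} G)))
    (d_simplicialAugmentation.{u, v} _ _)

/-- The reduced singular homology group `H_q(X; G)` in degree `q : ℤ`: the homology of the
augmented singular chain complex, with `G` placed in degree `-1`. It is zero for `q < -1`. -/
def reducedSingularHomology (G : Type v) [AddCommGroup G] (X : Type u) [TopologicalSpace X] :
    ℤ → AddCommGrpCat.{max u v}
  | Int.ofNat n => (augmentedSingularChains G X).homology (n + 1)
  | Int.negSucc 0 => (augmentedSingularChains G X).homology 0
  | Int.negSucc (_ + 1) => AddCommGrpCat.of PUnit

end

/-! The mathematical content is one exact stretch of Mayer–Vietoris: for open `A`, `B`, if every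
reduced cycle in degree `q` bounds in `A` and in `B`, and every cycle in degree `q - 1` bounds in `A
∩ B`, then every cycle in degree `q` bounds in `A ∪ B` (`AcyclicAt.union`). Induction on the number
of sets follows by splitting off one set: its intersection with the union of the others is the union
of the pairwise intersections, a family with one set fewer (`AcyclicAt.iUnion`).

The Mayer–Vietoris step needs every cycle in `A ∪ B` to be homologous to a sum of a chain in `A` and
a chain in `B`. This is iterated barycentric subdivision: a natural operator chain homotopic to the
identity (`boundary_iterHomotopy`) whose simplices shrink geometrically (`iterate_subdivide_mem`),
combined with a Lebesgue number (`eventually_push_mem_sup`). The algebra is done once on integral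
chains of vertex tuples and carried to singular chains with any coefficients.

Chains are indexed by the number `n` of vertices, so homological degree is `n - 1`. The empty
simplex, `n = 0`, accounts for the augmentation and degree `-1` needs no separate argument. -/

noncomputable section

/-- Formal integral combinations of `n`-tuples of points of `Y`. -/
abbrev TupleChain (Y : Type*) (n : ℕ) := (Fin n → Y) →₀ ℤ

/-! ### Algebra of vertex tuples: cones, subdivision, chain homotopy -/

namespace TupleChain

variable {Y Z : Type*}

/-- The alternating sum of the faces of a tuple. -/
def boundary (n : ℕ) : TupleChain Y (n + 1) →ₗ[ℤ] TupleChain Y n :=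
  Finsupp.linearCombination ℤ fun v ↦
    ∑ i : Fin (n + 1), (-1 : ℤ) ^ (i : ℕ) • Finsupp.single (v ∘ i.succAbove) 1

/-- The cone over a chain with apex `y`. -/
def cone (y : Y) (n : ℕ) : TupleChain Y n →ₗ[ℤ] TupleChain Y (n + 1) :=
  Finsupp.linearCombination ℤ fun v ↦ Finsupp.single (Fin.cons y v : Fin (n + 1) → Y) 1

/-- The map induced on chains by a map of sets. -/
def map (f : Y → Z) (n : ℕ) : TupleChain Y n →ₗ[ℤ] TupleChain Z n :=
  Finsupp.linearCombination ℤ fun v ↦ Finsupp.single (f ∘ v) 1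

theorem boundary_single (n : ℕ) (v : Fin (n + 1) → Y) :
    boundary n (Finsupp.single v 1) =
      ∑ i : Fin (n + 1), (-1 : ℤ) ^ (i : ℕ) • Finsupp.single (v ∘ i.succAbove) 1 := by
  simp [boundary]

theorem cone_single (y : Y) (n : ℕ) (v : Fin n → Y) :
    cone y n (Finsupp.single v 1) = Finsupp.single (Fin.cons y v : Fin (n + 1) → Y) 1 := by
  simp [cone]

theorem map_single (f : Y → Z) (n : ℕ) (v : Fin n → Y) :
    map f n (Finsupp.single v 1) = Finsupp.single (f ∘ v) 1 := by
  simp [map]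

theorem hom_ext {n : ℕ} {M : Type*} [AddCommGroup M] {f g : TupleChain Y n →ₗ[ℤ] M}
    (h : ∀ v, f (Finsupp.single v 1) = g (Finsupp.single v 1)) : f = g :=
  Finsupp.lhom_ext' fun v ↦ LinearMap.ext_ring (h v)

theorem boundary_cone_zero (y : Y) (c : TupleChain Y 0) : boundary 0 (cone y 0 c) = c := by
  refine LinearMap.congr_fun (f := boundary 0 ∘ₗ cone y 0) (g := .id) (hom_ext fun v ↦ ?_) c
  simp only [LinearMap.comp_apply, cone_single, boundary_single, LinearMap.id_apply]
  rw [Fin.sum_univ_one]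
  simp only [Fin.val_zero, pow_zero, one_smul]
  congr 1

theorem boundary_cone_succ (y : Y) (n : ℕ) (c : TupleChain Y (n + 1)) :
    boundary (n + 1) (cone y (n + 1) c) = c - cone y n (boundary n c) := by
  refine LinearMap.congr_fun (f := boundary (n + 1) ∘ₗ cone y (n + 1))
    (g := .id - cone y n ∘ₗ boundary n) (hom_ext fun v ↦ ?_) c
  simp only [LinearMap.comp_apply, cone_single, boundary_single, LinearMap.id_apply,
    LinearMap.sub_apply]
  rw [Fin.sum_univ_succ, map_sum, sub_eq_add_neg, ← Finset.sum_neg_distrib]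
  congr 1
  · simp only [Fin.val_zero, pow_zero, one_smul]
    congr 1
  · refine Finset.sum_congr rfl fun i _ ↦ ?_
    rw [map_smul, cone_single, ← neg_smul, Fin.val_succ, pow_succ]
    congr 1
    · ring
    · congr 1
      ext j
      refine Fin.cases ?_ (fun j ↦ ?_) j <;> simp

/-- A tuple is the cone over its tail with its first entry as apex, so the cone formula reduces the
claim to lower length without cancelling signs. -/
theorem boundary_boundary : ∀ (n : ℕ) (c : TupleChain Y (n + 2)),
    boundary n (boundary (n + 1) c) = 0 := by
  intro n
  induction n with
  | zero =>
    intro c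
    refine LinearMap.congr_fun (f := boundary 0 ∘ₗ boundary 1) (g := 0) (hom_ext fun v ↦ ?_) c
    have hv : Finsupp.single v (1 : ℤ) = cone (v 0) 1 (Finsupp.single (Fin.tail v) 1) := by
      rw [cone_single, Fin.cons_self_tail]
    rw [LinearMap.comp_apply, hv, boundary_cone_succ, map_sub, boundary_cone_zero, sub_self]
    rfl
  | succ n ih =>
    intro c
    refine LinearMap.congr_fun (f := boundary (n + 1) ∘ₗ boundary (n + 2)) (g := 0)
      (hom_ext fun v ↦ ?_) c
    have hv : Finsupp.single v (1 : ℤ) = cone (v 0) (n + 2) (Finsupp.single (Fin.tail v) 1) := by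
      rw [cone_single, Fin.cons_self_tail]
    rw [LinearMap.comp_apply, hv, boundary_cone_succ, map_sub, boundary_cone_succ, ih, map_zero,
      sub_zero, sub_self]
    rfl

theorem map_boundary (f : Y → Z) (n : ℕ) (c : TupleChain Y (n + 1)) :
    map f n (boundary n c) = boundary n (map f (n + 1) c) := by
  refine LinearMap.congr_fun (f := map f n ∘ₗ boundary n) (g := boundary n ∘ₗ map f (n + 1))
    (hom_ext fun v ↦ ?_) c
  simp only [LinearMap.comp_apply, map_single, boundary_single, map_sum, map_smul]
  rfl

theorem map_cone (f : Y → Z) (y : Y) (n : ℕ) (c : TupleChain Y n) :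
    map f (n + 1) (cone y n c) = cone (f y) n (map f n c) := by
  refine LinearMap.congr_fun (f := map f (n + 1) ∘ₗ cone y n) (g := cone (f y) n ∘ₗ map f n)
    (hom_ext fun v ↦ ?_) c
  simp only [LinearMap.comp_apply, map_single, cone_single]
  congr 1
  ext j
  refine Fin.cases ?_ (fun j ↦ ?_) j <;> simp

/-- Subdivision of chains, coning off the subdivided boundary from the centre `b v`. -/
def subdivide (b : ∀ n : ℕ, (Fin (n + 1) → Y) → Y) : ∀ n, TupleChain Y n →ₗ[ℤ] TupleChain Y n
  | 0 => .id
  | n + 1 => Finsupp.linearCombination ℤ fun v ↦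
      cone (b n v) n (subdivide b n (boundary n (Finsupp.single v 1)))

/-- The chain homotopy from the identity to the subdivision. -/
def homotopy (b : ∀ n : ℕ, (Fin (n + 1) → Y) → Y) :
    ∀ n, TupleChain Y n →ₗ[ℤ] TupleChain Y (n + 1)
  | 0 => 0
  | n + 1 => Finsupp.linearCombination ℤ fun v ↦
      cone (b n v) (n + 1)
        (Finsupp.single v 1 - homotopy b n (boundary n (Finsupp.single v 1)))

variable (b : ∀ n : ℕ, (Fin (n + 1) → Y) → Y) (b' : ∀ n : ℕ, (Fin (n + 1) → Z) → Z)

theorem subdivide_single (n : ℕ) (v : Fin (n + 1) → Y) :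
    subdivide b (n + 1) (Finsupp.single v 1) =
      cone (b n v) n (subdivide b n (boundary n (Finsupp.single v 1))) := by
  simp [subdivide]

theorem homotopy_single (n : ℕ) (v : Fin (n + 1) → Y) :
    homotopy b (n + 1) (Finsupp.single v 1) = cone (b n v) (n + 1)
        (Finsupp.single v 1 - homotopy b n (boundary n (Finsupp.single v 1))) := by
  simp [homotopy]

/-- In the cone formula the correction term is the cone over the boundary of a subdivided boundary;
by induction that boundary is zero. -/
theorem boundary_subdivide : ∀ (n : ℕ) (c : TupleChain Y (n + 1)),
    boundary n (subdivide b (n + 1) c) = subdivide b n (boundary n c) := by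
  intro n
  induction n with
  | zero =>
    intro c
    refine LinearMap.congr_fun (f := boundary 0 ∘ₗ subdivide b 1)
      (g := subdivide b 0 ∘ₗ boundary 0) (hom_ext fun v ↦ ?_) c
    rw [LinearMap.comp_apply, subdivide_single, boundary_cone_zero]
    rfl
  | succ n ih =>
    intro c
    refine LinearMap.congr_fun (f := boundary (n + 1) ∘ₗ subdivide b (n + 2))
      (g := subdivide b (n + 1) ∘ₗ boundary (n + 1)) (hom_ext fun v ↦ ?_) c
    rw [LinearMap.comp_apply, subdivide_single, boundary_cone_succ, ih, boundary_boundary,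
      map_zero, map_zero, sub_zero]
    rfl

/-- By induction `v - T ∂v` has boundary `S ∂v`, where `T` is the homotopy and `S` the subdivision.
Coning it from the centre of `v` therefore gives boundary `v - T ∂v - S v`. -/
theorem boundary_homotopy : ∀ (n : ℕ) (c : TupleChain Y (n + 1)),
    boundary (n + 1) (homotopy b (n + 1) c) + homotopy b n (boundary n c) =
      c - subdivide b (n + 1) c := by
  intro n
  induction n with
  | zero =>
    intro c
    refine LinearMap.congr_fun (f := boundary 1 ∘ₗ homotopy b 1 + homotopy b 0 ∘ₗ boundary 0)
      (g := .id - subdivide b 1) (hom_ext fun v ↦ ?_) c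
    simp only [LinearMap.add_apply, LinearMap.comp_apply, LinearMap.sub_apply,
      LinearMap.id_apply, homotopy_single, subdivide_single, boundary_cone_succ]
    simp [homotopy, subdivide]
  | succ n ih =>
    intro c
    refine LinearMap.congr_fun
      (f := boundary (n + 2) ∘ₗ homotopy b (n + 2) + homotopy b (n + 1) ∘ₗ boundary (n + 1))
      (g := .id - subdivide b (n + 2)) (hom_ext fun v ↦ ?_) c
    have h := ih (boundary (n + 1) (Finsupp.single v 1))
    rw [boundary_boundary, map_zero, add_zero] at h
    simp only [LinearMap.add_apply, LinearMap.comp_apply, LinearMap.sub_apply,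
      LinearMap.id_apply, homotopy_single, subdivide_single, boundary_cone_succ]
    rw [map_sub (boundary (n + 1)), h, sub_sub_cancel]
    abel

section Naturality

variable {b b'} {f : Y → Z} (hf : ∀ n (v : Fin (n + 1) → Y), f (b n v) = b' n (f ∘ v))
include hf

/-- The hypothesis `hf` says that `f` carries centres to centres; it is later applied to affine maps
of simplices and their centroids. -/
theorem map_subdivide : ∀ (n : ℕ) (c : TupleChain Y n),
    map f n (subdivide b n c) = subdivide b' n (map f n c) := by
  intro n
  induction n with
  | zero => intro c; rfl
  | succ n ih =>
    intro c
    refine LinearMap.congr_fun (f := map f (n + 1) ∘ₗ subdivide b (n + 1))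
      (g := subdivide b' (n + 1) ∘ₗ map f (n + 1)) (hom_ext fun v ↦ ?_) c
    simp only [LinearMap.comp_apply, subdivide_single, map_cone, ih, map_boundary, map_single, hf]

theorem map_homotopy : ∀ (n : ℕ) (c : TupleChain Y n),
    map f (n + 1) (homotopy b n c) = homotopy b' n (map f n c) := by
  intro n
  induction n with
  | zero => intro c; simp [homotopy]
  | succ n ih =>
    intro c
    refine LinearMap.congr_fun (f := map f (n + 2) ∘ₗ homotopy b (n + 1))
      (g := homotopy b' (n + 1) ∘ₗ map f (n + 1)) (hom_ext fun v ↦ ?_) c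
    simp only [LinearMap.comp_apply, homotopy_single, map_cone, ih, map_boundary, map_single, hf,
      map_sub]

end Naturality

/-- The chain homotopy from the identity to the `k`-fold subdivision. -/
def iterHomotopy (n : ℕ) : ℕ → TupleChain Y n →ₗ[ℤ] TupleChain Y (n + 1)
  | 0 => 0
  | k + 1 => homotopy b n + iterHomotopy n k ∘ₗ subdivide b n

/-- The sum telescopes: `c - S c` comes from one homotopy, `S c - S^(k+1) c` from the remaining `k`.
-/
theorem boundary_iterHomotopy (n k : ℕ) (c : TupleChain Y (n + 1)) :
    boundary (n + 1) (iterHomotopy b (n + 1) k c) + iterHomotopy b n k (boundary n c) =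
      c - (subdivide b (n + 1))^[k] c := by
  induction k generalizing c with
  | zero => simp [iterHomotopy]
  | succ k ih =>
    have h1 := boundary_homotopy b n c
    have h2 := ih (subdivide b (n + 1) c)
    rw [boundary_subdivide] at h2
    simp only [iterHomotopy, LinearMap.add_apply, LinearMap.comp_apply, map_add,
      Function.iterate_succ_apply]
    rw [← sub_add_sub_cancel c (subdivide b (n + 1) c), ← h1, ← h2]
    abel

theorem map_iterHomotopy {b : ∀ n : ℕ, (Fin (n + 1) → Y) → Y}
    {b' : ∀ n : ℕ, (Fin (n + 1) → Z) → Z} {f : Y → Z}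
    (hf : ∀ n (v : Fin (n + 1) → Y), f (b n v) = b' n (f ∘ v)) (n k : ℕ) (c : TupleChain Y n) :
    map f (n + 1) (iterHomotopy b n k c) = iterHomotopy b' n k (map f n c) := by
  induction k generalizing c with
  | zero => simp [iterHomotopy]
  | succ k ih =>
    simp only [iterHomotopy, LinearMap.add_apply, LinearMap.comp_apply, map_add, ih,
      map_homotopy hf, map_subdivide hf]

end TupleChain

/-! ### Affine maps and centroids of standard simplices -/

namespace stdSimplex

variable {n m p : ℕ}

/-- The convex combination of the points `v i` of a standard simplex with weights `t i`. -/
def comb (v : Fin n → stdSimplex ℝ (Fin m)) (t : stdSimplex ℝ (Fin n)) : stdSimplex ℝ (Fin m) :=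
  ⟨fun k ↦ ∑ i, t i * v i k,
    fun k ↦ Finset.sum_nonneg fun i _ ↦ mul_nonneg (zero_le t i) (zero_le (v i) k), by
      rw [Finset.sum_comm]
      simp_rw [← Finset.mul_sum, sum_eq_one, mul_one, sum_eq_one]⟩

theorem comb_apply (v : Fin n → stdSimplex ℝ (Fin m)) (t : stdSimplex ℝ (Fin n)) (k : Fin m) :
    comb v t k = ∑ i, t i * v i k := rfl

theorem continuous_comb (v : Fin n → stdSimplex ℝ (Fin m)) : Continuous (comb v) := by
  refine Continuous.subtype_mk (continuous_pi fun k ↦ ?_) _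
  refine continuous_finsetSum _ fun i _ ↦ Continuous.mul ?_ continuous_const
  exact (continuous_apply i).comp continuous_subtype_val

theorem comb_comb (u : Fin n → stdSimplex ℝ (Fin m)) (v : Fin p → stdSimplex ℝ (Fin n))
    (t : stdSimplex ℝ (Fin p)) : comb u (comb v t) = comb (comb u ∘ v) t := by
  ext k
  simp only [comb_apply, Function.comp_apply, Finset.sum_mul, Finset.mul_sum]
  rw [Finset.sum_comm]
  simp_rw [mul_assoc]

theorem comb_vertex (v : Fin n → stdSimplex ℝ (Fin m)) (i : Fin n) : comb v (vertex i) = v i := by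
  ext k
  rw [comb_apply, Finset.sum_eq_single i]
  · simp
  · intro j _ hj
    simp [Pi.single_eq_of_ne hj]
  · simp

theorem comb_vertex_comp (f : Fin n → Fin m) (t : stdSimplex ℝ (Fin n)) :
    comb (fun i ↦ vertex (f i)) t = stdSimplex.map f t := by
  ext k
  rw [comb_apply, stdSimplex.map_coe, FunOnFinite.linearMap_apply_apply, Finset.sum_filter]
  refine Finset.sum_congr rfl fun i _ ↦ ?_
  by_cases h : f i = k
  · simp [h]
  · simp [h]

theorem comb_vertex_self (t : stdSimplex ℝ (Fin n)) : comb vertex t = t := by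
  rw [← stdSimplex.map_id_apply t]
  exact comb_vertex_comp _root_.id _ |>.trans (by simp)

/-- The centroid of a nonempty tuple of points. -/
def centroid (m n : ℕ) (v : Fin (n + 1) → stdSimplex ℝ (Fin m)) : stdSimplex ℝ (Fin m) :=
  comb v barycenter

theorem comb_centroid (u : Fin n → stdSimplex ℝ (Fin m)) (p : ℕ)
    (v : Fin (p + 1) → stdSimplex ℝ (Fin n)) :
    comb u (centroid n p v) = centroid m p (comb u ∘ v) :=
  comb_comb _ _ _

theorem comb_mem_convexHull (v : Fin n → stdSimplex ℝ (Fin m)) (t : stdSimplex ℝ (Fin n)) :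
    (comb v t : Fin m → ℝ) ∈ convexHull ℝ (Set.range fun i ↦ (v i : Fin m → ℝ)) := by
  have h : ((comb v t).1 : Fin m → ℝ) = ∑ i, t i • (v i : Fin m → ℝ) := by
    ext k
    rw [Finset.sum_apply]
    rfl
  change (comb v t).1 ∈ _
  rw [h]
  exact (convex_convexHull ℝ _).sum_mem (fun i _ ↦ zero_le t i) (sum_eq_one t)
    fun i _ ↦ subset_convexHull ℝ _ ⟨i, rfl⟩

theorem dist_le_of_mem_convexHull {v : Fin n → stdSimplex ℝ (Fin m)} {x y : stdSimplex ℝ (Fin m)}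
    {r : ℝ} (hx : (x : Fin m → ℝ) ∈ convexHull ℝ (Set.range fun i ↦ (v i : Fin m → ℝ)))
    (h : ∀ i, dist (v i) y ≤ r) : dist x y ≤ r := by
  have : convexHull ℝ (Set.range fun i ↦ (v i : Fin m → ℝ)) ⊆ Metric.closedBall (y : Fin m → ℝ) r :=
    convexHull_min (by rintro _ ⟨i, rfl⟩; exact h i) (convex_closedBall _ _)
  exact this hx

theorem dist_centroid_le {v : Fin (n + 1) → stdSimplex ℝ (Fin m)} {δ : ℝ}
    (h : ∀ i j, dist (v i) (v j) ≤ δ) (j : Fin (n + 1)) :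
    dist (v j) (centroid m n v) ≤ n / (n + 1) * δ := by
  have hδ : 0 ≤ δ := dist_nonneg.trans (h j j)
  have hn : (0 : ℝ) < n + 1 := by positivity
  have hb : 0 ≤ (n : ℝ) / (n + 1) * δ := by positivity
  rw [Subtype.dist_eq, dist_pi_le_iff hb]
  intro k
  -- The term `i = j` vanishes, leaving `n` differences of size at most `δ` divided by `n + 1`; this
  -- is the source of the factor `n / (n + 1)`.
  have h1 : (v j).1 k - (centroid m n v).1 k =
      (n + 1 : ℝ)⁻¹ * ∑ i ∈ Finset.univ.erase j, (v j k - v i k) := by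
    have : (centroid m n v).1 k = (n + 1 : ℝ)⁻¹ * ∑ i, v i k := by
      rw [Finset.mul_sum]
      exact (comb_apply v barycenter k).trans
        (Finset.sum_congr rfl fun i _ ↦
          congrArg (· * v i k) ((barycenter_apply i).trans (by simp)))
    have hs : ∑ i ∈ Finset.univ.erase j, (v j k - v i k) = ∑ i, (v j k - v i k) :=
      Finset.sum_erase _ (sub_self _)
    rw [this, hs, Finset.sum_sub_distrib, mul_sub]
    congr 1
    rw [Finset.sum_const, Finset.card_univ, Fintype.card_fin, nsmul_eq_mul]
    push_cast
    field_simp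
    rfl
  rw [Real.dist_eq, h1, abs_mul, abs_of_pos (inv_pos.2 hn), div_mul_eq_mul_div, div_eq_inv_mul]
  refine mul_le_mul_of_nonneg_left ?_ (inv_pos.2 hn).le
  refine (Finset.abs_sum_le_sum_abs _ _).trans ?_
  refine (Finset.sum_le_card_nsmul _ _ δ fun i _ ↦ ?_).trans ?_
  · exact (dist_le_pi_dist (v j).1 (v i).1 k).trans (h j i)
  · simp

end stdSimplex

/-! ### Mesh of iterated subdivisions -/

namespace TupleChain

open stdSimplex

variable {m : ℕ}

/-- The `n`-tuples of points of the standard simplex with mutual distances at most `δ`. -/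
def fine (m n : ℕ) (δ : ℝ) : Set (Fin n → stdSimplex ℝ (Fin m)) :=
  {w | ∀ i j, dist (w i) (w j) ≤ δ}

/-- The `n`-tuples of points in the convex hull of the points of `v`. -/
def inHull {p : ℕ} (n : ℕ) (v : Fin p → stdSimplex ℝ (Fin m)) : Set (Fin n → stdSimplex ℝ (Fin m)) :=
  {w | ∀ i, (w i : Fin m → ℝ) ∈ convexHull ℝ (Set.range fun i ↦ (v i : Fin m → ℝ))}

theorem map_mem_supported {Y M : Type*} [AddCommGroup M] {n : ℕ} {S : Set (Fin n → Y)}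
    (f : TupleChain Y n →ₗ[ℤ] M) (Q : Submodule ℤ M)
    (h : ∀ v ∈ S, f (Finsupp.single v 1) ∈ Q) {c : TupleChain Y n}
    (hc : c ∈ Finsupp.supported ℤ ℤ S) : f c ∈ Q := by
  rw [Finsupp.supported_eq_span_single] at hc
  refine (Submodule.span_le.2 ?_ : _ ≤ Q.comap f) hc
  rintro _ ⟨v, hv, rfl⟩
  exact h v hv

/-- The hull condition is carried along because it bounds the distance from the new centroid to the
vertices of the subdivided faces. The ratio is fixed by `N`, since `n / (n + 1)` increases with `n`
and faces of every lower dimension occur. -/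
theorem subdivide_single_mem {δ : ℝ} {N : ℕ} : ∀ {n : ℕ} (_ : n ≤ N + 1)
    (v : Fin n → stdSimplex ℝ (Fin m)) (_ : v ∈ fine m n δ),
    subdivide (centroid m) n (Finsupp.single v 1) ∈
      Finsupp.supported ℤ ℤ (fine m n (N / (N + 1) * δ) ∩ inHull n v) := by
  intro n
  induction n with
  | zero =>
    intro _ v _
    exact Finsupp.single_mem_supported ℤ _ ⟨fun i ↦ i.elim0, fun i ↦ i.elim0⟩
  | succ n ih =>
    intro hn v hv
    have hδ : 0 ≤ δ := dist_nonneg.trans (hv 0 0)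
    rw [subdivide_single, boundary_single, map_sum, map_sum]
    refine Submodule.sum_mem _ fun i _ ↦ ?_
    rw [map_smul, map_smul]
    refine Submodule.smul_mem _ _ ?_
    refine map_mem_supported _ _ (fun w hw ↦ ?_)
      (ih (by omega) (v ∘ i.succAbove) fun j k ↦ hv _ _)
    rw [cone_single]
    refine Finsupp.single_mem_supported ℤ _ ?_
    have hw' : ∀ j, (w j : Fin m → ℝ) ∈ convexHull ℝ (Set.range fun i ↦ (v i : Fin m → ℝ)) :=
      fun j ↦ convexHull_mono (by rintro _ ⟨k, rfl⟩; exact ⟨i.succAbove k, rfl⟩) (hw.2 j)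
    have hr : (n : ℝ) / (n + 1) ≤ N / (N + 1) := by
      have : (n : ℝ) ≤ N := by exact_mod_cast Nat.le_of_succ_le_succ hn
      rw [div_le_div_iff₀ (by positivity) (by positivity)]
      linarith
    have hb : ∀ j, dist (w j) (centroid m n v) ≤ N / (N + 1) * δ := fun j ↦
      (dist_le_of_mem_convexHull (hw' j) (dist_centroid_le hv)).trans
        (mul_le_mul_of_nonneg_right hr hδ)
    refine ⟨fun j k ↦ ?_, fun j ↦ ?_⟩
    · refine Fin.cases ?_ (fun j ↦ ?_) j <;> refine Fin.cases ?_ (fun k ↦ ?_) k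
      · simp only [dist_self]
        positivity
      · rw [dist_comm]
        simpa using hb k
      · simpa using hb j
      · simpa using hw.1 j k
    · refine Fin.cases ?_ (fun j ↦ ?_) j
      · exact comb_mem_convexHull v _
      · simpa using hw' j

theorem iterate_subdivide_mem {δ : ℝ} {N n : ℕ} (hn : n ≤ N + 1) (k : ℕ)
    {c : TupleChain (stdSimplex ℝ (Fin m)) n} (hc : c ∈ Finsupp.supported ℤ ℤ (fine m n δ)) :
    (subdivide (centroid m) n)^[k] c ∈
      Finsupp.supported ℤ ℤ (fine m n ((N / (N + 1) : ℝ) ^ k * δ)) := by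
  induction k generalizing c with
  | zero => simpa using hc
  | succ k ih =>
    rw [Function.iterate_succ_apply', pow_succ', mul_assoc]
    refine map_mem_supported _ _ (fun v hv ↦ ?_) (ih hc)
    exact Finsupp.supported_mono Set.inter_subset_left (subdivide_single_mem hn v hv)

theorem exists_iterate_subdivide_mem (m n : ℕ) {ε : ℝ} (hε : 0 < ε)
    (v : Fin n → stdSimplex ℝ (Fin m)) : ∃ K, ∀ k ≥ K,
    (subdivide (centroid m) n)^[k] (Finsupp.single v 1) ∈ Finsupp.supported ℤ ℤ (fine m n ε) := by
  set D := Metric.diam (Set.univ : Set (stdSimplex ℝ (Fin m)))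
  have hv : Finsupp.single v (1 : ℤ) ∈ Finsupp.supported ℤ ℤ (fine m n D) :=
    Finsupp.single_mem_supported ℤ _ fun i j ↦
      Metric.dist_le_diam_of_mem isCompact_univ.isBounded (Set.mem_univ _) (Set.mem_univ _)
  have hr : (n : ℝ) / (n + 1) < 1 := by
    rw [div_lt_one (by positivity)]
    linarith
  have ht : Filter.Tendsto (fun k : ℕ ↦ ((n : ℝ) / (n + 1)) ^ k * D) .atTop (nhds 0) := by
    simpa using (tendsto_pow_atTop_nhds_zero_of_lt_one (by positivity) hr).mul_const D
  obtain ⟨K, hK⟩ := Filter.eventually_atTop.1 (ht.eventually_lt_const hε)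
  refine ⟨K, fun k hk ↦ Finsupp.supported_mono (fun w hw i j ↦ ?_)
    (iterate_subdivide_mem (N := n) (by omega) k hv)⟩
  exact (hw i j).trans (hK k hk).le

end TupleChain

/-- Singular chains with coefficients in `M` on simplices with `n` vertices; for `n = 0` this is
a copy of `M`, spanned by the empty simplex. -/
abbrev SingularChain (X : Type*) [TopologicalSpace X] (M : Type*) [AddCommGroup M] (n : ℕ) :=
  C(stdSimplex ℝ (Fin n), X) →₀ M

/-! ### Singular chains, subdivision and small simplices -/

namespace SingularChain

open stdSimplex TupleChain

variable {X : Type*} [TopologicalSpace X] {M : Type*} [AddCommGroup M]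

/-- The `i`-th face inclusion of standard simplices. -/
def faceMap {n : ℕ} (i : Fin (n + 1)) : C(stdSimplex ℝ (Fin n), stdSimplex ℝ (Fin (n + 1))) :=
  ⟨stdSimplex.map i.succAbove, stdSimplex.continuous_map _⟩

/-- `stdSimplex.comb` as a continuous map. -/
def combMap {n m : ℕ} (v : Fin n → stdSimplex ℝ (Fin m)) :
    C(stdSimplex ℝ (Fin n), stdSimplex ℝ (Fin m)) :=
  ⟨comb v, continuous_comb v⟩

theorem combMap_comp_faceMap {n m : ℕ} (v : Fin (n + 1) → stdSimplex ℝ (Fin m)) (i : Fin (n + 1)) :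
    (combMap v).comp (faceMap i) = combMap (v ∘ i.succAbove) := by
  ext1 t
  change comb v (stdSimplex.map i.succAbove t) = comb (v ∘ i.succAbove) t
  rw [← comb_vertex_comp, comb_comb]
  congr 1
  funext j
  exact comb_vertex v _

theorem combMap_comp_combMap {n m p : ℕ} (u : Fin n → stdSimplex ℝ (Fin m))
    (v : Fin p → stdSimplex ℝ (Fin n)) :
    (combMap u).comp (combMap v) = combMap (comb u ∘ v) := by
  ext1 t
  exact comb_comb u v t

theorem combMap_vertex (n : ℕ) : combMap (vertex : Fin n → stdSimplex ℝ (Fin n)) = .id _ := by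
  ext1 t
  exact comb_vertex_self t

/-- The boundary of singular chains; for `n = 0` it is the augmentation. -/
def boundary (n : ℕ) : SingularChain X M (n + 1) →+ SingularChain X M n :=
  Finsupp.liftAddHom fun σ ↦
    ∑ i : Fin (n + 1), (-1 : ℤ) ^ (i : ℕ) • Finsupp.singleAddHom (σ.comp (faceMap i))

theorem boundary_single (n : ℕ) (σ : C(stdSimplex ℝ (Fin (n + 1)), X)) (g : M) :
    boundary n (Finsupp.single σ g) =
      ∑ i : Fin (n + 1), (-1 : ℤ) ^ (i : ℕ) • Finsupp.single (σ.comp (faceMap i)) g := by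
  simp [boundary]

/-- The image of a chain of affine simplices under a singular simplex. -/
def push {m : ℕ} (σ : C(stdSimplex ℝ (Fin m), X)) (n : ℕ) :
    TupleChain (stdSimplex ℝ (Fin m)) n →ₗ[ℤ] (M →+ SingularChain X M n) :=
  Finsupp.linearCombination ℤ fun v ↦ Finsupp.singleAddHom (σ.comp (combMap v))

theorem push_single {m : ℕ} (σ : C(stdSimplex ℝ (Fin m), X)) (n : ℕ)
    (v : Fin n → stdSimplex ℝ (Fin m)) :
    push (M := M) σ n (Finsupp.single v 1) = Finsupp.singleAddHom (σ.comp (combMap v)) := by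
  simp [push]

theorem boundary_push {m : ℕ} (σ : C(stdSimplex ℝ (Fin m), X)) (n : ℕ)
    (c : TupleChain (stdSimplex ℝ (Fin m)) (n + 1)) (g : M) :
    boundary n (push σ (n + 1) c g) = push σ n (TupleChain.boundary n c) g := by
  refine LinearMap.congr_fun
    (f := (((boundary n).comp ((AddMonoidHom.eval g).comp
      (push (M := M) σ (n + 1)).toAddMonoidHom))).toIntLinearMap)
    (g := ((AddMonoidHom.eval g).comp
      (push (M := M) σ n ∘ₗ TupleChain.boundary n).toAddMonoidHom).toIntLinearMap)
    (TupleChain.hom_ext fun v ↦ ?_) c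
  change boundary n (push (M := M) σ (n + 1) (Finsupp.single v 1) g) =
    push (M := M) σ n (TupleChain.boundary n (Finsupp.single v 1)) g
  rw [push_single, TupleChain.boundary_single, map_sum, Finsupp.singleAddHom_apply,
    boundary_single, AddMonoidHom.finsetSum_apply]
  refine Finset.sum_congr rfl fun i _ ↦ ?_
  rw [map_smul, push_single, ContinuousMap.comp_assoc, combMap_comp_faceMap]
  rfl

theorem push_map {m p : ℕ} (σ : C(stdSimplex ℝ (Fin m), X)) (u : Fin p → stdSimplex ℝ (Fin m))
    (n : ℕ) (c : TupleChain (stdSimplex ℝ (Fin p)) n) :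
    push (M := M) σ n (TupleChain.map (comb u) n c) = push (σ.comp (combMap u)) n c := by
  refine LinearMap.congr_fun (f := push (M := M) σ n ∘ₗ TupleChain.map (comb u) n)
    (g := push (σ.comp (combMap u)) n) (TupleChain.hom_ext fun v ↦ ?_) c
  rw [LinearMap.comp_apply, map_single, push_single, push_single, ContinuousMap.comp_assoc,
    combMap_comp_combMap]

/-- The affine simplex of all vertices of the standard simplex. -/
def fundamental (n : ℕ) : TupleChain (stdSimplex ℝ (Fin n)) n := Finsupp.single vertex 1

theorem push_fundamental {n : ℕ} (σ : C(stdSimplex ℝ (Fin n), X)) (g : M) :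
    push σ n (fundamental n) g = Finsupp.single σ g := by
  rw [fundamental, push_single, combMap_vertex, ContinuousMap.comp_id, Finsupp.singleAddHom_apply]

/-- The operation on singular chains given by a chain of affine simplices in the standard
simplex. -/
def act {m n : ℕ} (c : TupleChain (stdSimplex ℝ (Fin m)) n) :
    SingularChain X M m →+ SingularChain X M n :=
  Finsupp.liftAddHom fun σ ↦ push σ n c

theorem act_single {m n : ℕ} (c : TupleChain (stdSimplex ℝ (Fin m)) n)
    (σ : C(stdSimplex ℝ (Fin m), X)) (g : M) : act c (Finsupp.single σ g) = push σ n c g := by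
  simp [act]

/-- A face of `σ` is `σ` composed with an affine map, so naturality of `F` allows it to be computed
inside the simplex that is the domain of `σ`. -/
theorem act_boundary_single {m n : ℕ}
    (F : ∀ p : ℕ, TupleChain (stdSimplex ℝ (Fin p)) m →ₗ[ℤ] TupleChain (stdSimplex ℝ (Fin p)) n)
    (hF : ∀ (u : Fin m → stdSimplex ℝ (Fin (m + 1))) c,
      TupleChain.map (comb u) n (F m c) = F (m + 1) (TupleChain.map (comb u) m c))
    (σ : C(stdSimplex ℝ (Fin (m + 1)), X)) (g : M) :
    act (F m (fundamental m)) (boundary m (Finsupp.single σ g)) =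
      push σ n (F (m + 1) (TupleChain.boundary m (fundamental (m + 1)))) g := by
  rw [boundary_single, fundamental, fundamental, TupleChain.boundary_single, map_sum, map_sum,
    map_sum, AddMonoidHom.finsetSum_apply]
  refine Finset.sum_congr rfl fun i _ ↦ ?_
  have hu : faceMap i = combMap (vertex ∘ i.succAbove) := by
    rw [← combMap_comp_faceMap, combMap_vertex, ContinuousMap.id_comp]
  have hv : (comb (vertex ∘ i.succAbove) ∘ vertex : Fin m → stdSimplex ℝ (Fin (m + 1))) =
      vertex ∘ i.succAbove := funext fun j ↦ comb_vertex _ j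
  rw [map_zsmul, act_single, hu, ← push_map, hF, map_single, hv, map_smul, map_smul]
  rfl

theorem boundary_act_iterHomotopy (n k : ℕ) (z : SingularChain X M (n + 1)) :
    boundary (n + 1) (act (iterHomotopy (centroid (n + 1)) (n + 1) k (fundamental (n + 1))) z) +
      act (iterHomotopy (centroid n) n k (fundamental n)) (boundary n z) =
    z - act ((subdivide (centroid (n + 1)) (n + 1))^[k] (fundamental (n + 1))) z := by
  induction z using Finsupp.induction_linear with
  | zero => simp
  | add x y hx hy =>
    simp only [map_add]
    rw [add_sub_add_comm, ← hx, ← hy]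
    abel
  | single σ g =>
    rw [act_single, act_single, boundary_push,
      act_boundary_single (fun p ↦ iterHomotopy (centroid p) n k)
        (fun u c ↦ map_iterHomotopy (comb_centroid u) n k c),
      ← AddMonoidHom.add_apply, ← map_add, boundary_iterHomotopy, map_sub,
      AddMonoidHom.sub_apply, push_fundamental]

theorem boundary_boundary (n : ℕ) (z : SingularChain X M (n + 2)) :
    boundary n (boundary (n + 1) z) = 0 := by
  induction z using Finsupp.induction_linear with
  | zero => simp
  | add x y hx hy => rw [map_add, map_add, hx, hy, add_zero]
  | single σ g =>
    rw [← push_fundamental, boundary_push, boundary_push, TupleChain.boundary_boundary, map_zero,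
      AddMonoidHom.zero_apply]

variable (M) in
/-- The singular chains supported in a subset. -/
def chainsIn (A : Set X) (n : ℕ) : Submodule ℤ (SingularChain X M n) :=
  Finsupp.supported M ℤ {σ | Set.range σ ⊆ A}

theorem chainsIn_mono {A B : Set X} (h : A ⊆ B) (n : ℕ) : chainsIn M A n ≤ chainsIn M B n :=
  Finsupp.supported_mono fun _ hσ ↦ hσ.trans h

theorem mem_chainsIn_inter {A B : Set X} {n : ℕ} {z : SingularChain X M n}
    (hA : z ∈ chainsIn M A n) (hB : z ∈ chainsIn M B n) : z ∈ chainsIn M (A ∩ B) n :=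
  fun _ hσ ↦ Set.subset_inter (hA hσ) (hB hσ)

theorem push_mem {m n : ℕ} {σ : C(stdSimplex ℝ (Fin m), X)} {Q : Submodule ℤ (SingularChain X M n)}
    {S : Set (Fin n → stdSimplex ℝ (Fin m))} (g : M)
    (h : ∀ v ∈ S, Finsupp.single (σ.comp (combMap v)) g ∈ Q)
    {c : TupleChain (stdSimplex ℝ (Fin m)) n} (hc : c ∈ Finsupp.supported ℤ ℤ S) :
    push σ n c g ∈ Q := by
  refine TupleChain.map_mem_supported ((AddMonoidHom.eval g).comp
      (push (M := M) σ n).toAddMonoidHom).toIntLinearMap Q (fun v hv ↦ ?_) hc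
  change push (M := M) σ n (Finsupp.single v 1) g ∈ Q
  rw [push_single]
  exact h v hv

theorem push_mem_chainsIn {A : Set X} {m n : ℕ} {σ : C(stdSimplex ℝ (Fin m), X)}
    (hσ : Set.range σ ⊆ A) (c : TupleChain (stdSimplex ℝ (Fin m)) n) (g : M) :
    push σ n c g ∈ chainsIn M A n :=
  push_mem (S := Set.univ) g
    (fun _ _ ↦ Finsupp.single_mem_supported ℤ _ ((Set.range_comp_subset_range _ σ).trans hσ))
    (by simp)

theorem act_mem_chainsIn {A : Set X} {m n : ℕ} (c : TupleChain (stdSimplex ℝ (Fin m)) n)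
    {z : SingularChain X M m} (hz : z ∈ chainsIn M A m) : act c z ∈ chainsIn M A n := by
  rw [act, Finsupp.liftAddHom_apply]
  exact Submodule.sum_mem _ fun σ hσ ↦ push_mem_chainsIn (hz hσ) c _

theorem boundary_mem_chainsIn {A : Set X} {n : ℕ} {z : SingularChain X M (n + 1)}
    (hz : z ∈ chainsIn M A (n + 1)) : boundary n z ∈ chainsIn M A n := by
  have h : boundary n z = ∑ σ ∈ z.support, boundary n (Finsupp.single σ (z σ)) := by
    rw [← map_sum]
    exact congrArg _ (Finsupp.sum_single z).symm
  rw [h]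
  refine Submodule.sum_mem _ fun σ hσ ↦ ?_
  rw [boundary_single]
  exact Submodule.sum_mem _ fun i _ ↦ Submodule.smul_mem _ _ (Finsupp.single_mem_supported ℤ _
    ((Set.range_comp_subset_range _ σ).trans (hz hσ)))

/-- The convexity of balls is used twice, once for each endpoint, to reduce to distances between
vertices. -/
theorem dist_comb_le {m n : ℕ} {v : Fin n → stdSimplex ℝ (Fin m)} {δ : ℝ} (hv : v ∈ fine m n δ)
    (s t : stdSimplex ℝ (Fin n)) : dist (comb v s) (comb v t) ≤ δ := by
  refine dist_le_of_mem_convexHull (comb_mem_convexHull v s) fun i ↦ ?_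
  rw [dist_comm]
  exact dist_le_of_mem_convexHull (comb_mem_convexHull v t) fun j ↦ hv j i

/-- "Eventually" rather than "for some `k`" lets a single `k` serve all the simplices of a chain. -/
theorem eventually_push_mem_sup {A B : Set X} (hA : IsOpen A) (hB : IsOpen B) {n : ℕ}
    {σ : C(stdSimplex ℝ (Fin n), X)} (hσ : Set.range σ ⊆ A ∪ B) (g : M) :
    ∀ᶠ k in .atTop, push σ n ((subdivide (centroid n) n)^[k] (fundamental n)) g ∈
      chainsIn M A n ⊔ chainsIn M B n := by
  obtain ⟨δ, hδ, h⟩ := lebesgue_number_lemma_of_metric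
    (c := fun b : Bool ↦ σ ⁻¹' (if b then A else B)) isCompact_univ
    (fun b ↦ IsOpen.preimage σ.continuous (by cases b <;> simpa)) (fun x _ ↦ by
      rw [Set.mem_iUnion]
      rcases hσ ⟨x, rfl⟩ with hx | hx
      · exact ⟨true, by simpa using hx⟩
      · exact ⟨false, by simpa using hx⟩)
  -- Half the Lebesgue number makes the simplices fit in an open ball, where the inequality is
  -- strict.
  obtain ⟨K, hK⟩ := exists_iterate_subdivide_mem n n (half_pos hδ) vertex
  filter_upwards [Filter.eventually_ge_atTop K] with k hk
  refine push_mem g (fun v hv ↦ ?_) (hK k hk)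
  -- For `n = 0` there is no point to centre a ball at, but the empty simplex lies in `A`.
  rcases isEmpty_or_nonempty (stdSimplex ℝ (Fin n)) with hn | ⟨⟨s⟩⟩
  · refine Submodule.mem_sup_left (Finsupp.single_mem_supported ℤ _ ?_)
    rw [Set.mem_ofPred_eq, Set.range_eq_empty]
    exact Set.empty_subset _
  · obtain ⟨b, hb⟩ := h (comb v s) (Set.mem_univ _)
    have hr : Set.range (σ.comp (combMap v)) ⊆ if b then A else B := by
      rintro _ ⟨t, rfl⟩
      refine hb ?_
      exact (dist_comb_le hv t s).trans_lt (half_lt_self hδ)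
    cases b
    · exact Submodule.mem_sup_right (Finsupp.single_mem_supported ℤ _ (by simpa using hr))
    · exact Submodule.mem_sup_left (Finsupp.single_mem_supported ℤ _ (by simpa using hr))

theorem exists_act_mem_sup {A B : Set X} (hA : IsOpen A) (hB : IsOpen B) {n : ℕ}
    {z : SingularChain X M n} (hz : z ∈ chainsIn M (A ∪ B) n) :
    ∃ k, act ((subdivide (centroid n) n)^[k] (fundamental n)) z ∈
      chainsIn M A n ⊔ chainsIn M B n := by
  have h : ∀ᶠ k in Filter.atTop, ∀ σ ∈ z.support,
      push σ n ((subdivide (centroid n) n)^[k] (fundamental n)) (z σ) ∈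
        chainsIn M A n ⊔ chainsIn M B n :=
    (Filter.eventually_all_finset _).2 fun σ hσ ↦ eventually_push_mem_sup hA hB (hz hσ) _
  obtain ⟨k, hk⟩ := h.exists
  refine ⟨k, ?_⟩
  rw [act, Finsupp.liftAddHom_apply]
  exact Submodule.sum_mem _ fun σ hσ ↦ hk σ hσ

/-! ### Mayer–Vietoris and induction on the number of sets -/

/-- The cycles of the augmented singular chain complex. -/
def IsCycle : ∀ {n : ℕ}, SingularChain X M n → Prop
  | 0, _ => True
  | n + 1, z => boundary n z = 0

theorem isCycle_boundary : ∀ {n : ℕ} (z : SingularChain X M (n + 1)), IsCycle (boundary n z)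
  | 0, _ => trivial
  | n + 1, z => boundary_boundary n z

variable (M) in
/-- Every cycle in `A` on simplices with `n` vertices bounds in `A`. -/
def AcyclicAt (A : Set X) (n : ℕ) : Prop :=
  ∀ z ∈ chainsIn M A n, IsCycle z → ∃ w ∈ chainsIn M A (n + 1), boundary n w = z

/-- Subdivide `z` into `a + b` with `a` in `A` and `b` in `B`. Then `∂a = -∂b` is a cycle in `A ∩
B`, say `∂c`; the cycles `a - c` and `b + c` bound in `A` and `B`, and their sum is homologous to
`z`. -/
theorem AcyclicAt.union {A B : Set X} (hA : IsOpen A) (hB : IsOpen B) {n : ℕ}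
    (h1 : AcyclicAt M A (n + 1)) (h2 : AcyclicAt M B (n + 1)) (h3 : AcyclicAt M (A ∩ B) n) :
    AcyclicAt M (A ∪ B) (n + 1) := by
  intro z hz hc
  obtain ⟨k, hk⟩ := exists_act_mem_sup hA hB hz
  have hT := boundary_act_iterHomotopy n k z
  have hc' : boundary n z = 0 := hc
  rw [hc', map_zero, add_zero] at hT
  obtain ⟨a, ha, b, hb, hab⟩ := Submodule.mem_sup.1 hk
  rw [← hab] at hT
  have hd : boundary n a + boundary n b = 0 := by
    have := boundary_boundary n
      (act (iterHomotopy (centroid (n + 1)) (n + 1) k (fundamental (n + 1))) z)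
    rw [hT, map_sub, hc', map_add, zero_sub, neg_eq_zero] at this
    exact this
  have haB : boundary n a ∈ chainsIn M B n := by
    rw [eq_neg_of_add_eq_zero_left hd]
    exact Submodule.neg_mem _ (boundary_mem_chainsIn hb)
  obtain ⟨c, hcm, hca⟩ :=
    h3 _ (mem_chainsIn_inter (boundary_mem_chainsIn ha) haB) (isCycle_boundary a)
  obtain ⟨p, hp, hp'⟩ := h1 (a - c)
    (Submodule.sub_mem _ ha (chainsIn_mono Set.inter_subset_left _ hcm))
    (show boundary n (a - c) = 0 by rw [map_sub, hca, sub_self])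
  obtain ⟨q, hq, hq'⟩ := h2 (b + c)
    (Submodule.add_mem _ hb (chainsIn_mono Set.inter_subset_right _ hcm))
    (show boundary n (b + c) = 0 by rw [map_add, hca, add_comm, hd])
  refine ⟨_, Submodule.add_mem _ (act_mem_chainsIn
    (iterHomotopy (centroid (n + 1)) (n + 1) k (fundamental (n + 1))) hz) (Submodule.add_mem _
    (chainsIn_mono Set.subset_union_left _ hp) (chainsIn_mono Set.subset_union_right _ hq)), ?_⟩
  rw [map_add, map_add, hT, hp', hq']
  abel

theorem AcyclicAt.iUnion {m : ℕ} {l : ℕ} {A : Fin (m + 1) → Set X} (hA : ∀ i, IsOpen (A i))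
    (h : ∀ (s : Finset (Fin (m + 1))) (n : ℕ), s.Nonempty → n + s.card = m + 1 + l →
      AcyclicAt M (⋂ i ∈ s, A i) n) :
    AcyclicAt M (⋃ i, A i) (m + l) := by
  induction m generalizing l with
  | zero =>
    have := h {0} l (by simp) (by simp [add_comm])
    have hU : ⋃ i, A i = ⋂ i ∈ ({0} : Finset (Fin 1)), A i := by
      ext x
      simp [Fin.exists_fin_one]
    rwa [hU, zero_add]
  | succ m ih =>
    have hU : ⋃ i, A i = (⋃ i : Fin (m + 1), A i.succ) ∪ A 0 := by
      ext x
      simp [Fin.exists_fin_succ, or_comm]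
    have e : m + 1 + l = m + l + 1 := by omega
    rw [hU, e]
    refine AcyclicAt.union (isOpen_iUnion fun i ↦ hA _) (hA 0) ?_ ?_ ?_
    -- One set fewer with the degree unchanged, so the slack `l` grows by one.
    · refine ih (l := l + 1) (fun i ↦ hA _) fun s n hs hn ↦ ?_
      have := h (s.map (Fin.succEmb _)) n (hs.map) (by rw [Finset.card_map]; omega)
      convert this using 1
      ext x
      simp only [Set.mem_iInter, Finset.mem_map, Fin.coe_succEmb, forall_exists_index, and_imp,
        forall_apply_eq_imp_iff₂]
    · have := h {0} (m + l + 1) (by simp) (by simp; omega)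
      simpa using this
    -- Here the degree drops by one along with the number of sets, so `l` stays; adjoining the index
    -- `0` to `s` makes up the count.
    · rw [Set.iUnion_inter]
      refine ih (fun i ↦ (hA _).inter (hA 0)) fun s n hs hn ↦ ?_
      have := h (insert 0 (s.map (Fin.succEmb _))) n (by simp) (by
        rw [Finset.card_insert_of_notMem (by simp), Finset.card_map]
        omega)
      convert this using 1
      -- Membership in `A 0` is recovered from any one index of `s`.
      obtain ⟨i, hi⟩ := hs
      ext x
      simp only [Set.mem_iInter, Set.mem_inter_iff, Finset.mem_insert, Finset.mem_map,
        Fin.coe_succEmb, forall_eq_or_imp, forall_exists_index, and_imp,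
        forall_apply_eq_imp_iff₂]
      exact ⟨fun hx ↦ ⟨(hx i hi).2, fun j hj ↦ (hx j hj).1⟩, fun hx j hj ↦ ⟨hx.2 j hj, hx.1⟩⟩

end SingularChain

/-! ### Comparison with the categorical augmented complex -/

namespace SingularChain

section Comparison

variable (G : Type v) [AddCommGroup G] (Y : Type u) [TopologicalSpace Y]

/-- The comparison map from `SingularChain` to the augmented singular chain complex. -/
def toAugmented : ∀ n : ℕ,
    SingularChain Y (ULift.{u} G) n →+ ((augmentedSingularChains G Y).X n : Type (max u v))
  | 0 => (Finsupp.liftAddHom fun _ ↦ AddMonoidHom.id (ULift.{u} G) :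
      SingularChain Y (ULift.{u} G) 0 →+ ULift.{u} G)
  | n + 1 => (Finsupp.liftAddHom fun σ ↦
      ((TopCat.toSSet.obj (TopCat.of Y)).ιChainComplex (R := AddCommGrpCat.of (ULift.{u} G)) (n := n)
        (((TopCat.of Y).toSSetObjEquiv (.op (.mk n))).symm σ)).hom :
      SingularChain Y (ULift.{u} G) (n + 1) →+
        (((TopCat.toSSet.obj (TopCat.of Y)).chainComplex
          (AddCommGrpCat.of (ULift.{u} G))).X n : Type (max u v)))

variable {G Y}

theorem toAugmented_zero_single (σ : C(stdSimplex ℝ (Fin 0), Y)) (g : ULift.{u} G) :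
    toAugmented G Y 0 (Finsupp.single σ g) = g :=
  Finsupp.liftAddHom_apply_single (fun _ ↦ AddMonoidHom.id (ULift.{u} G)) σ g

theorem toAugmented_succ_single (n : ℕ) (σ : C(stdSimplex ℝ (Fin (n + 1)), Y)) (g : ULift.{u} G) :
    toAugmented G Y (n + 1) (Finsupp.single σ g) =
      ((TopCat.toSSet.obj (TopCat.of Y)).ιChainComplex (R := AddCommGrpCat.of (ULift.{u} G)) (n := n)
        (((TopCat.of Y).toSSetObjEquiv (.op (.mk n))).symm σ)).hom g :=
  Finsupp.liftAddHom_apply_single (fun σ ↦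
      ((TopCat.toSSet.obj (TopCat.of Y)).ιChainComplex (R := AddCommGrpCat.of (ULift.{u} G)) (n := n)
        (((TopCat.of Y).toSSetObjEquiv (.op (.mk n))).symm σ)).hom) σ g

variable (G Y) in
/-- The inverse of `toAugmented` in positive degrees. -/
def ofChainComplex (n : ℕ) :
    ((TopCat.toSSet.obj (TopCat.of Y)).chainComplex (AddCommGrpCat.of (ULift.{u} G))).X n ⟶
      AddCommGrpCat.of (SingularChain Y (ULift.{u} G) (n + 1)) :=
  Sigma.desc fun x ↦ AddCommGrpCat.ofHom
    (Finsupp.singleAddHom ((TopCat.of Y).toSSetObjEquiv (.op (.mk n)) x))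

theorem ι_ofChainComplex (n : ℕ)
    (x : (TopCat.toSSet.obj (TopCat.of Y)).obj (Opposite.op (SimplexCategory.mk n))) :
    (TopCat.toSSet.obj (TopCat.of Y)).ιChainComplex x ≫ ofChainComplex G Y n = AddCommGrpCat.ofHom
      (Finsupp.singleAddHom ((TopCat.of Y).toSSetObjEquiv (.op (.mk n)) x)) :=
  Sigma.ι_desc _ _

variable (G Y) in
theorem toAugmented_bijective (n : ℕ) : Function.Bijective (toAugmented G Y n) := by
  cases n with
  | zero =>
    -- There is exactly one map from the empty simplex, so chains with `n = 0` are a single copy of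
    -- the coefficients.
    have : IsEmpty (stdSimplex ℝ (Fin 0)) :=
      Set.isEmpty_coe_sort.2 (stdSimplex_of_isEmpty_index ℝ _)
    let _ : Unique C(stdSimplex ℝ (Fin 0), Y) :=
      { default := ⟨fun t ↦ isEmptyElim t, continuous_of_const fun t ↦ isEmptyElim t⟩
        uniq := fun σ ↦ ContinuousMap.ext fun t ↦ isEmptyElim t }
    refine ⟨fun x y hxy ↦ ?_, fun g ↦ ⟨Finsupp.single default g, toAugmented_zero_single _ g⟩⟩
    rw [Finsupp.unique_single x, Finsupp.unique_single y, toAugmented_zero_single,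
      toAugmented_zero_single] at hxy
    exact Finsupp.unique_ext hxy
  | succ n =>
    have h1 : ∀ z, (ofChainComplex G Y n).hom (toAugmented G Y (n + 1) z) = z := by
      intro z
      induction z using Finsupp.induction_linear with
      | zero => rw [map_zero]; exact map_zero _
      | add x y hx hy =>
        rw [map_add]
        exact (map_add _ _ _).trans (by rw [hx, hy])
      | single σ g =>
        rw [toAugmented_succ_single]
        have := ConcreteCategory.congr_hom (ι_ofChainComplex (G := G) n
          (((TopCat.of Y).toSSetObjEquiv (.op (.mk n))).symm σ)) g
        rw [Equiv.apply_symm_apply] at this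
        exact this
    have h2 : ofChainComplex G Y n ≫ AddCommGrpCat.ofHom (toAugmented G Y (n + 1)) = 𝟙 _ := by
      refine SSet.chainComplex_hom_ext fun x ↦ ?_
      rw [← Category.assoc, ι_ofChainComplex]
      ext g
      refine (toAugmented_succ_single n _ g).trans ?_
      rw [Equiv.symm_apply_apply]
      rfl
    exact ⟨Function.LeftInverse.injective h1, fun y ↦ ⟨_, ConcreteCategory.congr_hom h2 y⟩⟩

theorem toAugmented_boundary (n : ℕ) (z : SingularChain Y (ULift.{u} G) (n + 1)) :
    toAugmented G Y n (boundary n z) =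
      ((augmentedSingularChains G Y).d (n + 1) n).hom (toAugmented G Y (n + 1) z) := by
  induction z using Finsupp.induction_linear with
  | zero => simp
  | add x y hx hy => simp only [map_add, hx, hy]
  | single σ g =>
    rw [toAugmented_succ_single, boundary_single]
    cases n with
    | zero =>
      rw [Fin.sum_univ_one, Fin.val_zero, pow_zero, one_smul, toAugmented_zero_single]
      exact (ConcreteCategory.congr_hom (ι_simplicialAugmentation.{u, v} _
        (AddCommGrpCat.of (ULift.{u} G)) _) g).symm
    | succ n =>
      refine Eq.trans ?_ (ConcreteCategory.congr_hom (SSet.ιChainComplex_d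
        (R := AddCommGrpCat.of (ULift.{u} G)) (TopCat.toSSet.obj (TopCat.of Y))
        (((TopCat.of Y).toSSetObjEquiv (.op (.mk (n + 1)))).symm σ)) g).symm
      rw [map_sum]
      let ev : (AddCommGrpCat.of (ULift.{u} G) ⟶ ((TopCat.toSSet.obj (TopCat.of Y)).chainComplex
          (AddCommGrpCat.of (ULift.{u} G))).X n) →+ (((TopCat.toSSet.obj (TopCat.of Y)).chainComplex
          (AddCommGrpCat.of (ULift.{u} G))).X n : Type (max u v)) :=
        { toFun := fun f ↦ f.hom g, map_zero' := rfl, map_add' := fun _ _ ↦ rfl }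
      refine Eq.trans ?_ (map_sum ev _ _).symm
      refine Finset.sum_congr rfl fun i _ ↦ ?_
      rw [map_zsmul, toAugmented_succ_single]
      rfl

theorem acyclicAt_univ_of_isZero {n : ℕ} (h : IsZero ((augmentedSingularChains G Y).homology n)) :
    AcyclicAt (ULift.{u} G) (Set.univ : Set Y) n := by
  intro z _ hz
  suffices H : ∃ y, ((augmentedSingularChains G Y).d (n + 1) n).hom y = toAugmented G Y n z by
    obtain ⟨y, hy⟩ := H
    obtain ⟨w, rfl⟩ := (toAugmented_bijective G Y (n + 1)).2 y
    refine ⟨w, fun _ _ ↦ Set.subset_univ _, (toAugmented_bijective G Y n).1 ?_⟩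
    rw [toAugmented_boundary, hy]
  rw [← HomologicalComplex.exactAt_iff_isZero_homology] at h
  cases n with
  | zero =>
    -- Position `0` has no successor, so by convention its next index is `0` itself and the outgoing
    -- differential is zero.
    rw [HomologicalComplex.exactAt_iff' _ 1 0 0 (by simp) (by simp),
      ShortComplex.ab_exact_iff] at h
    refine h _ ?_
    change ((augmentedSingularChains G Y).d 0 0).hom _ = 0
    rw [HomologicalComplex.shape _ _ _ (by simp)]
    rfl
  | succ n =>
    rw [HomologicalComplex.exactAt_iff' _ (n + 2) (n + 1) n (by simp) (by simp),
      ShortComplex.ab_exact_iff] at h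
    refine h _ ((toAugmented_boundary n z).symm.trans ?_)
    rw [show boundary n z = 0 from hz, map_zero]
    rfl

theorem isZero_of_acyclicAt_univ {n : ℕ} (h : AcyclicAt (ULift.{u} G) (Set.univ : Set Y) n) :
    IsZero ((augmentedSingularChains G Y).homology n) := by
  rw [← HomologicalComplex.exactAt_iff_isZero_homology]
  have key : ∀ y, (∀ z, toAugmented G Y n z = y → IsCycle z) →
      ∃ w, ((augmentedSingularChains G Y).d (n + 1) n).hom w = y := by
    intro y hy
    obtain ⟨z, rfl⟩ := (toAugmented_bijective G Y n).2 y
    obtain ⟨w, -, hw⟩ := h z (fun _ _ ↦ Set.subset_univ _) (hy z rfl)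
    exact ⟨toAugmented G Y (n + 1) w, by rw [← hw, toAugmented_boundary]⟩
  cases n with
  | zero =>
    rw [HomologicalComplex.exactAt_iff' _ 1 0 0 (by simp) (by simp), ShortComplex.ab_exact_iff]
    exact fun y _ ↦ key y fun _ _ ↦ trivial
  | succ n =>
    rw [HomologicalComplex.exactAt_iff' _ (n + 2) (n + 1) n (by simp) (by simp),
      ShortComplex.ab_exact_iff]
    refine fun y hy ↦ key y fun z hz ↦ (toAugmented_bijective G Y n).1 ?_
    rw [toAugmented_boundary, map_zero, hz]
    exact hy

end Comparison

/-! ### Chains of a subspace as chains supported in it -/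

section Subspace

variable {X : Type*} [TopologicalSpace X] {M : Type*} [AddCommGroup M] (A : Set X)

/-- The map on simplices induced by the inclusion of a subspace. -/
def inclSimplex (n : ℕ) (σ : C(stdSimplex ℝ (Fin n), A)) : C(stdSimplex ℝ (Fin n), X) :=
  (⟨Subtype.val, continuous_subtype_val⟩ : C(A, X)).comp σ

theorem inclSimplex_injective (n : ℕ) : Function.Injective (inclSimplex A n) := fun _ _ h ↦
  ContinuousMap.ext fun t ↦ Subtype.ext (DFunLike.congr_fun h t)

variable (M) in
/-- The map on singular chains induced by the inclusion of a subspace. -/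
def incl (n : ℕ) : SingularChain A M n →+ SingularChain X M n :=
  Finsupp.mapDomain.addMonoidHom (inclSimplex A n)

theorem incl_single (n : ℕ) (σ : C(stdSimplex ℝ (Fin n), A)) (g : M) :
    incl M A n (Finsupp.single σ g) = Finsupp.single (inclSimplex A n σ) g :=
  Finsupp.mapDomain_single

theorem incl_injective (n : ℕ) : Function.Injective (incl M A n) :=
  Finsupp.mapDomain_injective (inclSimplex_injective A n)

theorem mem_chainsIn_iff_exists_incl {n : ℕ} {z : SingularChain X M n} :
    z ∈ chainsIn M A n ↔ ∃ y, incl M A n y = z := by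
  constructor
  · intro hz
    refine ⟨_, Finsupp.mapDomain_comapDomain _ (inclSimplex_injective A n) z fun σ hσ ↦ ?_⟩
    exact ⟨⟨fun t ↦ ⟨σ t, hz hσ ⟨t, rfl⟩⟩, by fun_prop⟩, rfl⟩
  · rintro ⟨y, rfl⟩ σ hσ
    classical
    obtain ⟨τ, -, rfl⟩ := Finset.mem_image.1 (Finsupp.mapDomain_support hσ)
    rintro _ ⟨t, rfl⟩
    exact (τ t).2

theorem incl_boundary (n : ℕ) (z : SingularChain A M (n + 1)) :
    incl M A n (boundary n z) = boundary n (incl M A (n + 1) z) := by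
  induction z using Finsupp.induction_linear with
  | zero => simp
  | add x y hx hy => simp only [map_add, hx, hy]
  | single σ g =>
    rw [boundary_single, incl_single, boundary_single, map_sum]
    refine Finset.sum_congr rfl fun i _ ↦ ?_
    rw [map_zsmul, incl_single]
    rfl

theorem isCycle_incl_iff {n : ℕ} {z : SingularChain A M n} : IsCycle (incl M A n z) ↔ IsCycle z := by
  cases n with
  | zero => exact Iff.rfl
  | succ n =>
    change boundary n _ = 0 ↔ boundary n z = 0
    rw [← incl_boundary, map_eq_zero_iff _ (incl_injective A n)]

/-- This passes between the intrinsic homology of a subspace and chains of `X`, among which all the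
sets can be compared. -/
theorem acyclicAt_iff_univ {n : ℕ} : AcyclicAt M A n ↔ AcyclicAt M (Set.univ : Set A) n := by
  constructor
  · intro h z _ hz
    obtain ⟨w, hw, hwz⟩ := h _ ((mem_chainsIn_iff_exists_incl A).2 ⟨z, rfl⟩)
      ((isCycle_incl_iff A).2 hz)
    obtain ⟨y, rfl⟩ := (mem_chainsIn_iff_exists_incl A).1 hw
    refine ⟨y, fun _ _ ↦ Set.subset_univ _, incl_injective A n ?_⟩
    rw [incl_boundary, hwz]
  · intro h z hz hc
    obtain ⟨y, rfl⟩ := (mem_chainsIn_iff_exists_incl A).1 hz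
    obtain ⟨w, -, rfl⟩ := h y (fun _ _ ↦ Set.subset_univ _) ((isCycle_incl_iff A).1 hc)
    exact ⟨_, (mem_chainsIn_iff_exists_incl A).2 ⟨w, rfl⟩, (incl_boundary A n w).symm⟩

end Subspace

end SingularChain

theorem reducedSingularHomology_eq (G : Type v) [AddCommGroup G] (Y : Type u) [TopologicalSpace Y]
    (n : ℕ) {q : ℤ} (hq : q = n - 1) :
    reducedSingularHomology G Y q = (augmentedSingularChains G Y).homology n := by
  subst hq
  cases n with
  | zero => rfl
  | succ n =>
    have h : ((n + 1 : ℕ) : ℤ) - 1 = Int.ofNat n := by simp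
    rw [h]
    rfl

end

theorem mainTheorem8 {X : Type u} [TopologicalSpace X] (G : Type v) [AddCommGroup G]
    [Nontrivial G] (m : ℕ) (hm : 1 ≤ m) (l : ℕ) (A : Fin m → Set X) (hA : ∀ i, IsOpen (A i))
    (h : ∀ (j : ℕ) (s : Finset (Fin m)), 1 ≤ j → j ≤ m → s.card = j →
      IsZero (reducedSingularHomology G (⋂ i ∈ s, A i : Set X) ((m : ℤ) - 1 - j + l))) :
    IsZero (reducedSingularHomology G (⋃ i, A i : Set X) ((m : ℤ) - 2 + l)) := by
  obtain ⟨m, rfl⟩ : ∃ k, m = k + 1 := ⟨m - 1, by omega⟩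
  -- With `m + 1` sets the target degree is `m - 1 + l`, that is, `m + l + 1 - 2`, hence simplices
  -- with `m + l` vertices.
  have key : SingularChain.AcyclicAt (ULift.{u} G) (⋃ i, A i) (m + l) := by
    refine SingularChain.AcyclicAt.iUnion hA fun s n hs hn ↦ ?_
    rw [SingularChain.acyclicAt_iff_univ]
    refine SingularChain.acyclicAt_univ_of_isZero ?_
    have := h s.card s hs.card_pos (by simpa using s.card_le_univ) rfl
    rwa [reducedSingularHomology_eq G _ n (by push_cast; omega)] at this
  rw [SingularChain.acyclicAt_iff_univ] at key
  rw [reducedSingularHomology_eq G _ (m + l) (by push_cast; omega)]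
  exact SingularChain.isZero_of_acyclicAt_univ key
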